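/- For a permutation $\pi=\pi_1\cdots\pi_n$ of $[n]$, $n\ge 1$, put $\pi_0=\pi_{n+1}=0$. An index $1\le i\le n$ is a double descent if $\pi_{i-1}>\pi_i>\pi_{i+1}$, a double rise if $\pi_{i-1}<\pi_i<\pi_{i+1}$, and a peak if $\pi_{i-1}<\pi_i>\pi_{i+1}$; a peak $i$ is of pattern $132$ if $\pi_{i-1}\le\pi_{i+1}$ and of pattern $231$ if $\pi_{i-1}>\pi_{i+1}$. Let $p_1(\pi),p_2(\pi),dd(\pi),dr(\pi)$ be the numbers of peaks of pattern $132$, peaks of pattern $231$, double descents and double rises of $\pi$, and set $Q_0(x,y,z,w,u,v)=w$ and, for $n\ge1$, $$Q_n(x,y,z,w,u,v)=\sum_{\pi\in\mathfrak S_n}x^{p_1(\pi)}v^{p_1(\pi)}u^{p_2(\pi)}z^{p_2(\pi)}y^{dd(\pi)}w^{dr(\pi)}.$$ For complex $a,z$ let $$D_a(z)=2^{a/2}\sqrt{\pi}\,e^{-z^2/4}\left(\frac{1}{\Gamma\left(\frac{1-a}{2}\right)}\,{}_1F_1\left(-\frac a2;\frac12;\frac{z^2}{2}\right)-\frac{\sqrt2\,z}{\Gamma\left(-\frac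 a2\right)}\,{}_1F_1\left(\frac{1-a}{2};\frac32;\frac{z^2}{2}\right)\right)$$ be the parabolic cylinder function, where ${}_1F_1(a;b;z)=\sum_{n\ge0}\frac{(a)_n}{(b)_n}\frac{z^n}{n!}$, $(a)_n=a(a+1)\cdots(a+n-1)$, and $1/\Gamma$ is $0$ at the poles of $\Gamma$. Let $x,y,z,w,u,v$ be complex numbers with $xv\ne zu$, and let $\delta,\hat\delta$ be any complex square roots, $\delta^2=xv-zu$ and $\hat\delta^2=zu-xv$. Put $$p=D_{\frac{zu-yw}{\delta^2}}\left(\frac{w-y}{\delta}\right),\quad q=D_{\frac{xv-yw}{\hat\delta^2}}\left(\frac{y-w}{\hat\delta}\right),\quad r=D_{\frac{xv-yw}{\delta^2}}\left(\frac{w-y}{\delta}\right),\quad s=D_{\frac{zu-yw}{\hat\delta^2}}\left(\frac{y-w}{\hat\delta}\right)$$ and $$\Delta(t)=(\hat\delta s-qy)\,D_{\frac{zu-yw}{\delta^2}}\left(\delta t+\frac{w-y}{\delta}\right)+(pw-\delta r)\,D_{\frac{xv-yw}{\hat\delta^2}}\left(\hat\delta t+\frac{y-w}{\hat\delta}\right).$$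 Then there is $\rho>0$ such that for all complex $t$ with $|t|<\rho$ we have $\Delta(t)\ne0$, the series below converges, and $$\sum_{n=0}^\infty Q_n(x,y,z,w,u,v)\frac{t^n}{n!}=\frac{(\delta^2t+w-y)(pw-\delta r)\,D_{\frac{xv-yw}{\hat\delta^2}}\left(\hat\delta t+\frac{y-w}{\hat\delta}\right)}{\Delta(t)}+\frac{\delta(\hat\delta s-qy)\,D_{\frac{xv-yw}{\delta^2}}\left(\delta t+\frac{w-y}{\delta}\right)+\hat\delta(pw-\delta r)\,D_{\frac{zu-yw}{\hat\delta^2}}\left(\hat\delta t+\frac{y-w}{\hat\delta}\right)}{\Delta(t)}.$$ -/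

import Mathlib

/-- The letter `π_i` of the word of a permutation `π` of `[n]`, with the convention
`π_0 = π_{n+1} = 0`. The permutation is an element of `Equiv.Perm (Fin n)`, so positions and values
are shifted by one: `π_i = π (i - 1) + 1` for `1 ≤ i ≤ n`. -/
def permLetter {n : ℕ} (π : Equiv.Perm (Fin n)) (i : ℕ) : ℕ :=
  if h : 1 ≤ i ∧ i ≤ n then (π ⟨i - 1, by omega⟩ : ℕ) + 1 else 0

/-- Number of peaks of pattern 132: `π_{i-1} < π_i > π_{i+1}` and `π_{i-1} ≤ π_{i+1}`. -/
def numPeak132 {n : ℕ} (π : Equiv.Perm (Fin n)) : ℕ :=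
  ((Finset.Icc 1 n).filter fun i =>
    permLetter π (i - 1) < permLetter π i ∧ permLetter π (i + 1) < permLetter π i ∧
      permLetter π (i - 1) ≤ permLetter π (i + 1)).card

/-- Number of peaks of pattern 231: `π_{i-1} < π_i > π_{i+1}` and `π_{i-1} > π_{i+1}`. -/
def numPeak231 {n : ℕ} (π : Equiv.Perm (Fin n)) : ℕ :=
  ((Finset.Icc 1 n).filter fun i =>
    permLetter π (i - 1) < permLetter π i ∧ permLetter π (i + 1) < permLetter π i ∧
      permLetter π (i + 1) < permLetter π (i - 1)).card

/-- Number of double descents: `π_{i-1} > π_i > π_{i+1}`. -/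
def numDoubleDescent {n : ℕ} (π : Equiv.Perm (Fin n)) : ℕ :=
  ((Finset.Icc 1 n).filter fun i =>
    permLetter π i < permLetter π (i - 1) ∧ permLetter π (i + 1) < permLetter π i).card

/-- Number of double rises: `π_{i-1} < π_i < π_{i+1}`. -/
def numDoubleRise {n : ℕ} (π : Equiv.Perm (Fin n)) : ℕ :=
  ((Finset.Icc 1 n).filter fun i =>
    permLetter π (i - 1) < permLetter π i ∧ permLetter π i < permLetter π (i + 1)).card

/-- The polynomial `Q_n(x, y, z, w, u, v)`, with the convention `Q_0 = w`. -/
def polyQ {R : Type*} [CommSemiring R] (n : ℕ) (x y z w u v : R) : R :=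
  if n = 0 then w
  else ∑ π : Equiv.Perm (Fin n),
    x ^ numPeak132 π * v ^ numPeak132 π * u ^ numPeak231 π * z ^ numPeak231 π *
      y ^ numDoubleDescent π * w ^ numDoubleRise π

/-- The confluent hypergeometric function `₁F₁(a; b; z) = ∑ (a)_n / (b)_n * z^n / n!`. -/
noncomputable def confluentHyp (a b z : ℂ) : ℂ :=
  ∑' n : ℕ, (ascPochhammer ℂ n).eval a / (ascPochhammer ℂ n).eval b * (z ^ n / (n.factorial : ℂ))

/-- The parabolic cylinder function `D_a(z)` of Whittaker and Watson. At a pole of `Γ` the value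
`1 / Γ` is `0`, which agrees with `Complex.Gamma` being `0` there. -/
noncomputable def parabolicCylD (a z : ℂ) : ℂ :=
  (2 : ℂ) ^ (a / 2) * (Real.sqrt Real.pi : ℂ) * Complex.exp (-z ^ 2 / 4) *
    (1 / Complex.Gamma ((1 - a) / 2) * confluentHyp (-a / 2) (1 / 2) (z ^ 2 / 2) -
      (Real.sqrt 2 : ℂ) * z / Complex.Gamma (-a / 2) *
        confluentHyp ((1 - a) / 2) (3 / 2) (z ^ 2 / 2))

/-!
Permutations of `[n + 1]` arise from permutations of `[n]` by inserting the new maximum `n + 1`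
into one of the `n + 1` gaps. Charging each gap to the larger of its two neighbours shows
(`sum_wordWeight_insertLetter`) that insertion acts on the weight of a permutation as the derivation
`w ↦ X`, `y ↦ Z`, `X, Z ↦ X y + Z w`, where `X = x v` and `Z = z u` are the weights of the two kinds
of peak. Hence, if functions `F, G, X, Z` of `t` solve `F' = X`, `G' = Z`, `X' = Z' = X G + Z F`
with initial values `w, y, x v, z u`, the `n`-th derivative of `F` at `0` is `Q_n`
(`hasDerivAt_polyQ`), and the Taylor series of `F` is the generating function.

The system has the first integrals `X - Z = x v - z u`, `F - G = (w - y) + (x v - z u) t =: L` and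
`X - F G = x v - y w`, so it reduces to the Riccati equation `F' = F (F - L) + (x v - y w)` with
`F 0 = w` (`hasSum_polyQ_of_riccati`). A quotient `F = N / Δ` solves it as soon as
`Δ' = (L / 2) Δ - N` and `N' = (x v - y w) Δ - (L / 2) N` (`hasDerivAt_div_of_linear_system`).
For the numerator and the denominator of the theorem these two equations are consequences of the
raising and lowering relations `D_a' = (z / 2) D_a - D_{a+1}` and
`D_{a+1}' = -(z / 2) D_{a+1} + (a + 1) D_a`, which are read off the Taylor series of the
even and the odd part of `exp (z² / 4) D_a(z)`. Finally `Δ 0` is, up to sign, `δ` times the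
Wronskian of `D_a(ζ)` and `D_{-a-1}(± i ζ)`; it is constant in `ζ`, and the reflection
formula for `Γ` shows that it does not vanish (`parabolicCylD_wronskian_ne_zero`).
-/

/-! ### Even and odd solutions of the Weber equation -/

theorem ascPochhammer_eval_half_mul (n : ℕ) :
    (ascPochhammer ℂ n).eval (1 / 2) * (4 ^ n * (n.factorial : ℂ)) = ((2 * n).factorial : ℂ) := by
  induction n with
  | zero => simp
  | succ n ih =>
    rw [ascPochhammer_succ_eval, show 2 * (n + 1) = 2 * n + 1 + 1 by ring, Nat.factorial_succ,
      Nat.factorial_succ, Nat.factorial_succ]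
    push_cast
    rw [← ih]
    ring

theorem ascPochhammer_eval_three_halves_mul (n : ℕ) :
    (ascPochhammer ℂ n).eval (3 / 2) * (4 ^ n * (n.factorial : ℂ)) =
      ((2 * n + 1).factorial : ℂ) := by
  induction n with
  | zero => simp
  | succ n ih =>
    rw [ascPochhammer_succ_eval, show 2 * (n + 1) + 1 = 2 * n + 1 + 1 + 1 by ring,
      Nat.factorial_succ (2 * n + 1 + 1), Nat.factorial_succ (2 * n + 1), Nat.factorial_succ n]
    push_cast
    rw [← ih]
    ring

theorem ascPochhammer_eval_succ_left (b : ℂ) (n : ℕ) :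
    (ascPochhammer ℂ (n + 1)).eval b = b * (ascPochhammer ℂ n).eval (b + 1) := by
  simp [ascPochhammer_succ_left]

theorem norm_ascPochhammer_eval_le (b : ℂ) (n : ℕ) :
    ‖(ascPochhammer ℂ n).eval b‖ ≤ (1 + ‖b‖) ^ n * n.factorial := by
  induction n with
  | zero => simp
  | succ n ih =>
    rw [ascPochhammer_succ_eval, norm_mul, Nat.factorial_succ]
    have h : ‖b + n‖ ≤ (1 + ‖b‖) * (n + 1) := by
      have := norm_add_le b (n : ℂ)
      rw [Complex.norm_natCast] at this
      nlinarith [norm_nonneg b, (Nat.cast_nonneg n : (0 : ℝ) ≤ n)]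
    calc _ ≤ ((1 + ‖b‖) ^ n * n.factorial) * ((1 + ‖b‖) * (n + 1)) := by gcongr
      _ = _ := by push_cast; ring

/-- The general term of the even function `₁F₁(b; 1/2; z²/2)`, written as a Taylor series. -/
noncomputable def weberEvenTerm (b : ℂ) (n : ℕ) (z : ℂ) : ℂ :=
  (ascPochhammer ℂ n).eval b * 2 ^ n * (z ^ (2 * n) / ((2 * n).factorial : ℂ))

/-- The general term of the odd function `z ₁F₁(b; 3/2; z²/2)`, written as a Taylor series. -/
noncomputable def weberOddTerm (b : ℂ) (n : ℕ) (z : ℂ) : ℂ :=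
  (ascPochhammer ℂ n).eval b * 2 ^ n * (z ^ (2 * n + 1) / ((2 * n + 1).factorial : ℂ))

/-- The even function `₁F₁(b; 1/2; z²/2)`. For `b = -a / 2`, its product with `exp (-z²/4)` solves
the Weber equation satisfied by `D_a`. -/
noncomputable def weberEven (b z : ℂ) : ℂ := ∑' n, weberEvenTerm b n z

/-- The odd function `z ₁F₁(b; 3/2; z²/2)`. For `b = (1 - a) / 2`, its product with `exp (-z²/4)`
solves the Weber equation satisfied by `D_a`. -/
noncomputable def weberOdd (b z : ℂ) : ℂ := ∑' n, weberOddTerm b n z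

/-- The `n`-th coefficients are `O(Cⁿ / n!)`, because `|(b)_n| ≤ (1 + |b|)ⁿ n!` and
`n!² ≤ (2n)!`. -/
theorem norm_weberTerm_coeff_le (b : ℂ) (n : ℕ) :
    ‖(ascPochhammer ℂ n).eval b * 2 ^ n‖ / ((2 * n).factorial : ℝ) ≤
      (2 * (1 + ‖b‖)) ^ n / (n.factorial : ℝ) := by
  have h1 : (n.factorial : ℝ) * n.factorial ≤ ((2 * n).factorial : ℝ) := by
    rw [two_mul]
    exact_mod_cast Nat.le_of_dvd (Nat.factorial_pos _)
      (Nat.factorial_mul_factorial_dvd_factorial_add n n)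
  have h0 : (0 : ℝ) < n.factorial := by exact_mod_cast n.factorial_pos
  rw [div_le_div_iff₀ (by exact_mod_cast Nat.factorial_pos _) h0, norm_mul, norm_pow,
    Complex.norm_ofNat]
  calc _ ≤ ((1 + ‖b‖) ^ n * n.factorial) * 2 ^ n * n.factorial := by
        gcongr; exact norm_ascPochhammer_eval_le b n
    _ = (2 * (1 + ‖b‖)) ^ n * ((n.factorial : ℝ) * n.factorial) := by rw [mul_pow]; ring
    _ ≤ _ := by gcongr

theorem norm_weberEvenTerm_le (b : ℂ) (n : ℕ) {z : ℂ} {R : ℝ} (hz : ‖z‖ ≤ R) :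
    ‖weberEvenTerm b n z‖ ≤ (2 * (1 + ‖b‖) * R ^ 2) ^ n / (n.factorial : ℝ) := by
  have h := norm_weberTerm_coeff_le b n
  rw [weberEvenTerm, norm_mul, norm_div, norm_pow, Complex.norm_natCast]
  calc _ = ‖(ascPochhammer ℂ n).eval b * 2 ^ n‖ / ((2 * n).factorial : ℝ) * ‖z‖ ^ (2 * n) := by ring
    _ ≤ (2 * (1 + ‖b‖)) ^ n / (n.factorial : ℝ) * R ^ (2 * n) := by gcongr
    _ = _ := by rw [mul_pow _ (R ^ 2), pow_mul]; ring

theorem norm_weberOddTerm_le (b : ℂ) (n : ℕ) {z : ℂ} {R : ℝ} (hz : ‖z‖ ≤ R) :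
    ‖weberOddTerm b n z‖ ≤ R * ((2 * (1 + ‖b‖) * R ^ 2) ^ n / (n.factorial : ℝ)) := by
  have h := norm_weberEvenTerm_le b n hz
  have hR : 0 ≤ R := (norm_nonneg z).trans hz
  have h2 : weberOddTerm b n z = z / ((2 * n + 1 : ℕ) : ℂ) * weberEvenTerm b n z := by
    rw [weberOddTerm, weberEvenTerm, Nat.factorial_succ, pow_succ]
    push_cast
    field_simp
  rw [h2, norm_mul, norm_div, Complex.norm_natCast]
  have h3 : ‖z‖ / ((2 * n + 1 : ℕ) : ℝ) ≤ R :=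
    (div_le_self (norm_nonneg z) (by exact_mod_cast Nat.le_add_left 1 _)).trans hz
  gcongr

theorem summable_weberEvenTerm (b z : ℂ) : Summable fun n => weberEvenTerm b n z :=
  .of_norm_bounded (Real.summable_pow_div_factorial _) fun n => norm_weberEvenTerm_le b n le_rfl

theorem summable_weberOddTerm (b z : ℂ) : Summable fun n => weberOddTerm b n z :=
  .of_norm_bounded ((Real.summable_pow_div_factorial _).mul_left _)
    fun n => norm_weberOddTerm_le b n le_rfl

theorem hasDerivAt_pow_succ_div_factorial (n : ℕ) (z : ℂ) :
    HasDerivAt (fun z : ℂ => z ^ (n + 1) / ((n + 1).factorial : ℂ))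
      (z ^ n / (n.factorial : ℂ)) z := by
  refine ((hasDerivAt_pow (n + 1) z).div_const ((n + 1).factorial : ℂ)).congr_deriv ?_
  rw [Nat.factorial_succ, Nat.add_sub_cancel]
  push_cast
  field_simp

theorem hasDerivAt_weberOddTerm (b : ℂ) (n : ℕ) (z : ℂ) :
    HasDerivAt (weberOddTerm b n) (weberEvenTerm b n z) z :=
  (hasDerivAt_pow_succ_div_factorial (2 * n) z).const_mul _

theorem hasDerivAt_weberEvenTerm_zero (b z : ℂ) : HasDerivAt (weberEvenTerm b 0) 0 z := by
  have : weberEvenTerm b 0 = fun _ => 1 := by ext; simp [weberEvenTerm]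
  rw [this]
  exact hasDerivAt_const z 1

theorem hasDerivAt_weberEvenTerm_succ (b : ℂ) (n : ℕ) (z : ℂ) :
    HasDerivAt (weberEvenTerm b (n + 1)) (2 * b * weberOddTerm (b + 1) n z) z := by
  refine ((hasDerivAt_pow_succ_div_factorial (2 * n + 1) z).const_mul
    ((ascPochhammer ℂ (n + 1)).eval b * 2 ^ (n + 1))).congr_deriv ?_
  rw [weberOddTerm, ascPochhammer_eval_succ_left]
  ring

theorem differentiable_weberEvenTerm (b : ℂ) (n : ℕ) : Differentiable ℂ (weberEvenTerm b n) := by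
  unfold weberEvenTerm; fun_prop

theorem hasDerivAt_weberOdd (b z : ℂ) : HasDerivAt (weberOdd b) (weberEven b z) z := by
  have hz : z ∈ Metric.ball (0 : ℂ) (‖z‖ + 1) := by simp
  have hle : ∀ (i : ℕ) (w : ℂ), w ∈ Metric.ball (0 : ℂ) (‖z‖ + 1) → ‖weberOddTerm b i w‖ ≤ _ :=
    fun i w hw => norm_weberOddTerm_le b i (mem_ball_zero_iff.1 hw).le
  have hsum := (Real.summable_pow_div_factorial (2 * (1 + ‖b‖) * (‖z‖ + 1) ^ 2)).mul_left (‖z‖ + 1)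
  have hd : ∀ i, DifferentiableOn ℂ (weberOddTerm b i) (Metric.ball (0 : ℂ) (‖z‖ + 1)) :=
    fun i w _ => (hasDerivAt_weberOddTerm b i w).differentiableAt.differentiableWithinAt
  have h1 := Complex.hasSum_deriv_of_summable_norm hsum hd Metric.isOpen_ball hle hz
  have h2 := Complex.differentiableOn_tsum_of_summable_norm hsum hd Metric.isOpen_ball hle
  simp only [(hasDerivAt_weberOddTerm b _ z).deriv] at h1
  have h3 := (h2.differentiableAt (Metric.isOpen_ball.mem_nhds hz)).hasDerivAt
  rwa [← h1.tsum_eq] at h3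

theorem hasDerivAt_weberEven (b z : ℂ) :
    HasDerivAt (weberEven b) (2 * b * weberOdd (b + 1) z) z := by
  have hz : z ∈ Metric.ball (0 : ℂ) (‖z‖ + 1) := by simp
  have hle : ∀ (i : ℕ) (w : ℂ), w ∈ Metric.ball (0 : ℂ) (‖z‖ + 1) → ‖weberEvenTerm b i w‖ ≤ _ :=
    fun i w hw => norm_weberEvenTerm_le b i (mem_ball_zero_iff.1 hw).le
  have hsum := Real.summable_pow_div_factorial (2 * (1 + ‖b‖) * (‖z‖ + 1) ^ 2)
  have hd : ∀ i, DifferentiableOn ℂ (weberEvenTerm b i) (Metric.ball (0 : ℂ) (‖z‖ + 1)) :=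
    fun i => (differentiable_weberEvenTerm b i).differentiableOn
  have h1 := Complex.hasSum_deriv_of_summable_norm hsum hd Metric.isOpen_ball hle hz
  have h2 := Complex.differentiableOn_tsum_of_summable_norm hsum hd Metric.isOpen_ball hle
  have h3 := (h2.differentiableAt (Metric.isOpen_ball.mem_nhds hz)).hasDerivAt
  rw [← h1.tsum_eq, h1.summable.tsum_eq_zero_add] at h3
  simp only [(hasDerivAt_weberEvenTerm_zero b z).deriv, zero_add,
    (hasDerivAt_weberEvenTerm_succ b _ z).deriv, tsum_mul_left] at h3
  exact h3

/-- Contiguous relation lowering the parameter of the even function. -/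
theorem weberEven_sub_mul_weberOdd (b z : ℂ) :
    weberEven b z - z * weberOdd b z = weberEven (b - 1) z := by
  have hE := (summable_weberEvenTerm b z).tsum_eq_zero_add
  have hE' := (summable_weberEvenTerm (b - 1) z).tsum_eq_zero_add
  have hs := (summable_nat_add_iff 1).2 (summable_weberEvenTerm b z)
  have hO := (summable_weberOddTerm b z).mul_left z
  rw [weberEven, weberEven, weberOdd, hE, hE', ← tsum_mul_left, add_sub_assoc, ← hs.tsum_sub hO]
  congr 1
  · simp [weberEvenTerm]
  · refine tsum_congr fun n => ?_
    have hp := ascPochhammer_eval_succ_left (b - 1) n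
    rw [sub_add_cancel] at hp
    rw [weberEvenTerm, weberEvenTerm, weberOddTerm, hp, ascPochhammer_succ_eval,
      show 2 * (n + 1) = 2 * n + 1 + 1 by ring, Nat.factorial_succ (2 * n + 1)]
    have h1 : (n : ℂ) + 1 ≠ 0 := Nat.cast_add_one_ne_zero n
    have h2 : ((2 * n + 1).factorial : ℂ) ≠ 0 := by exact_mod_cast Nat.factorial_ne_zero _
    rw [Nat.cast_mul, show ((2 * n + 1 + 1 : ℕ) : ℂ) = 2 * ((n : ℂ) + 1) by push_cast; ring]
    field_simp
    ring

/-- Contiguous relation `z E(b) - E(b)' = (1 - 2 b) O(b)` between the even function `E` and the odd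
function `O`. -/
theorem mul_weberEven_sub_mul_weberOdd (b z : ℂ) :
    z * weberEven b z - 2 * b * weberOdd (b + 1) z = (1 - 2 * b) * weberOdd b z := by
  have hE := (summable_weberEvenTerm b z).mul_left z
  have hO := (summable_weberOddTerm (b + 1) z).mul_left (2 * b)
  rw [weberEven, weberOdd, weberOdd, ← tsum_mul_left, ← tsum_mul_left, ← tsum_mul_left,
    ← hE.tsum_sub hO]
  refine tsum_congr fun n => ?_
  have hp := ascPochhammer_eval_succ_left b n
  rw [ascPochhammer_succ_eval] at hp
  have h1 : ((2 * n + 1 : ℕ) : ℂ) ≠ 0 := Nat.cast_ne_zero.2 (by omega)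
  have h2 : ((2 * n).factorial : ℂ) ≠ 0 := by exact_mod_cast Nat.factorial_ne_zero _
  rw [weberEvenTerm, weberOddTerm, weberOddTerm, Nat.factorial_succ]
  push_cast at h1 ⊢
  field_simp
  linear_combination (2 * z * z ^ (2 * n)) * hp

theorem confluentHyp_half (b z : ℂ) : confluentHyp b (1 / 2) (z ^ 2 / 2) = weberEven b z := by
  refine tsum_congr fun n => ?_
  have h := ascPochhammer_eval_half_mul n
  have h1 : ((2 * n).factorial : ℂ) ≠ 0 := by exact_mod_cast Nat.factorial_ne_zero _
  rw [← h] at h1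
  have h2 := left_ne_zero_of_mul h1
  have h3 := right_ne_zero_of_mul (right_ne_zero_of_mul h1)
  rw [weberEvenTerm, ← h, div_pow, ← pow_mul, show (4 : ℂ) = 2 * 2 by norm_num, mul_pow]
  field_simp

theorem mul_confluentHyp_three_halves (b z : ℂ) :
    z * confluentHyp b (3 / 2) (z ^ 2 / 2) = weberOdd b z := by
  rw [confluentHyp, ← tsum_mul_left]
  refine tsum_congr fun n => ?_
  have h := ascPochhammer_eval_three_halves_mul n
  have h1 : ((2 * n + 1).factorial : ℂ) ≠ 0 := by exact_mod_cast Nat.factorial_ne_zero _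
  rw [← h] at h1
  have h2 := left_ne_zero_of_mul h1
  have h3 := right_ne_zero_of_mul (right_ne_zero_of_mul h1)
  rw [weberOddTerm, ← h, div_pow, ← pow_mul, show (4 : ℂ) = 2 * 2 by norm_num, mul_pow, pow_succ z]
  field_simp

/-! ### Parabolic cylinder functions -/

/-- The value `D_a(0)`. -/
noncomputable def parabolicCylDZero (a : ℂ) : ℂ :=
  2 ^ (a / 2) * (Real.sqrt Real.pi : ℂ) * (1 / Complex.Gamma ((1 - a) / 2))

/-- The even and odd parts of `D_a` have coefficients `D_a(0)` and `D_a'(0) = -D_{a+1}(0)`. -/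
theorem parabolicCylD_eq (a z : ℂ) :
    parabolicCylD a z = Complex.exp (-z ^ 2 / 4) *
      (parabolicCylDZero a * weberEven (-a / 2) z -
        parabolicCylDZero (a + 1) * weberOdd ((1 - a) / 2) z) := by
  have h2 : (2 : ℂ) ^ ((a + 1) / 2) = 2 ^ (a / 2) * (Real.sqrt 2 : ℂ) := by
    rw [add_div, Complex.cpow_add _ _ two_ne_zero, Real.sqrt_eq_rpow,
      Complex.ofReal_cpow zero_le_two]
    norm_num
  rw [parabolicCylD, parabolicCylDZero, parabolicCylDZero, h2, confluentHyp_half,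
    ← mul_confluentHyp_three_halves, show (1 - (a + 1)) / 2 = -a / 2 by ring]
  ring

/-- The functional equation of `1 / Γ`, valid also at the poles of `Γ`. -/
theorem parabolicCylDZero_add_two (a : ℂ) :
    parabolicCylDZero (a + 2) = -(a + 1) * parabolicCylDZero a := by
  have h := Complex.one_div_Gamma_eq_self_mul_one_div_Gamma_add_one ((1 - (a + 2)) / 2)
  rw [show (1 - (a + 2)) / 2 + 1 = (1 - a) / 2 by ring] at h
  rw [parabolicCylDZero, parabolicCylDZero, one_div, one_div, h, add_div, div_self two_ne_zero,
    Complex.cpow_add _ _ two_ne_zero, Complex.cpow_one]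
  ring

theorem parabolicCylD_zero_right (a : ℂ) : parabolicCylD a 0 = parabolicCylDZero a := by
  have hE : weberEven (-a / 2) 0 = 1 := by
    rw [weberEven, (summable_weberEvenTerm _ _).tsum_eq_zero_add]
    simp [weberEvenTerm]
  have hO : weberOdd ((1 - a) / 2) 0 = 0 := by
    simp [weberOdd, weberOddTerm]
  rw [parabolicCylD_eq, hE, hO]
  simp

theorem hasDerivAt_parabolicCylD_even_odd (a z : ℂ) :
    HasDerivAt (parabolicCylD a) (Complex.exp (-z ^ 2 / 4) * (-z / 2) *
      (parabolicCylDZero a * weberEven (-a / 2) z -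
        parabolicCylDZero (a + 1) * weberOdd ((1 - a) / 2) z) + Complex.exp (-z ^ 2 / 4) *
      (parabolicCylDZero a * (2 * (-a / 2) * weberOdd (-a / 2 + 1) z) -
        parabolicCylDZero (a + 1) * weberEven ((1 - a) / 2) z)) z := by
  rw [show parabolicCylD a = _ from funext (parabolicCylD_eq a)]
  refine HasDerivAt.mul ?_ (((hasDerivAt_weberEven _ z).const_mul _).sub
    ((hasDerivAt_weberOdd _ z).const_mul _))
  exact ((((hasDerivAt_pow 2 z).fun_neg).div_const 4).congr_deriv (by push_cast; ring)).cexp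

/-- The raising relation `D_a' = (z/2) D_a - D_{a+1}`. -/
theorem hasDerivAt_parabolicCylD (a z : ℂ) :
    HasDerivAt (parabolicCylD a) (z / 2 * parabolicCylD a z - parabolicCylD (a + 1) z) z := by
  convert hasDerivAt_parabolicCylD_even_odd a z using 1
  have h1 := weberEven_sub_mul_weberOdd ((1 - a) / 2) z
  have h2 := mul_weberEven_sub_mul_weberOdd (-a / 2) z
  rw [parabolicCylD_eq, parabolicCylD_eq, show a + 1 + 1 = a + 2 by ring,
    parabolicCylDZero_add_two, show (1 - (a + 1)) / 2 = -a / 2 by ring,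
    show -(a + 1) / 2 = (1 - a) / 2 - 1 by ring, ← h1]
  linear_combination Complex.exp (-z ^ 2 / 4) * parabolicCylDZero a * h2

/-- The lowering relation `D_{a+1}' = -(z/2) D_{a+1} + (a+1) D_a`. -/
theorem hasDerivAt_parabolicCylD_add_one (a z : ℂ) :
    HasDerivAt (parabolicCylD (a + 1))
      (-(z / 2) * parabolicCylD (a + 1) z + (a + 1) * parabolicCylD a z) z := by
  convert hasDerivAt_parabolicCylD_even_odd (a + 1) z using 1
  rw [parabolicCylD_eq, parabolicCylD_eq, show a + 1 + 1 = a + 2 by ring,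
    parabolicCylDZero_add_two, show (1 - (a + 1)) / 2 = -a / 2 by ring,
    show -(a + 1) / 2 + 1 = (1 - a) / 2 by ring]
  ring

/-- The reflection formula for `Γ`, in terms of the values `D_a(0)`. -/
theorem parabolicCylDZero_mul_neg (a : ℂ) :
    parabolicCylDZero a * parabolicCylDZero (-a) = Complex.cos (Real.pi * a / 2) := by
  have h := Complex.Gamma_mul_Gamma_one_sub ((1 - a) / 2)
  rw [show 1 - (1 - a) / 2 = (1 - -a) / 2 by ring,
    show (Real.pi : ℂ) * ((1 - a) / 2) = Real.pi / 2 - Real.pi * a / 2 by ring,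
    Complex.sin_pi_div_two_sub] at h
  have hpi : (Real.sqrt Real.pi : ℂ) * (Real.sqrt Real.pi : ℂ) = Real.pi := by
    exact_mod_cast Real.mul_self_sqrt Real.pi_pos.le
  have h2 : (2 : ℂ) ^ (a / 2) * 2 ^ (-a / 2) = 1 := by
    rw [← Complex.cpow_add _ _ two_ne_zero, neg_div, add_neg_cancel, Complex.cpow_zero]
  have hpi0 : (Real.pi : ℂ) ≠ 0 := by exact_mod_cast Real.pi_ne_zero
  calc _ = ((2 : ℂ) ^ (a / 2) * 2 ^ (-a / 2)) *
        ((Real.sqrt Real.pi : ℂ) * (Real.sqrt Real.pi : ℂ)) *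
        (Complex.Gamma ((1 - a) / 2) * Complex.Gamma ((1 - -a) / 2))⁻¹ := by
        rw [parabolicCylDZero, parabolicCylDZero, mul_inv]; ring
    _ = _ := by rw [h, h2, hpi, inv_div, one_mul, mul_div_cancel₀ _ hpi0]

/-- The Wronskian of `D_a(z)` and `D_{-a-1}(κz)`, for `κ² = -1`, does not vanish. The raising
relation expresses it, up to sign, as below; by both relations it is constant, and at
`z = 0` it is `κ (cos - κ sin)(πa/2)`. -/
theorem parabolicCylD_wronskian_ne_zero (a κ z : ℂ) (hκ : κ ^ 2 = -1) :
    κ * parabolicCylD a z * parabolicCylD (-a) (κ * z) -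
      parabolicCylD (a + 1) z * parabolicCylD (-a - 1) (κ * z) +
      z * parabolicCylD a z * parabolicCylD (-a - 1) (κ * z) ≠ 0 := by
  set W : ℂ → ℂ := fun z => κ * parabolicCylD a z * parabolicCylD (-a) (κ * z) -
      parabolicCylD (a + 1) z * parabolicCylD (-a - 1) (κ * z) +
      z * parabolicCylD a z * parabolicCylD (-a - 1) (κ * z) with hW
  have hd : ∀ z, HasDerivAt W 0 z := fun z => by
    have hκz : HasDerivAt (fun z => κ * z) κ z := by
      simpa using (hasDerivAt_id z).const_mul κ
    have f := hasDerivAt_parabolicCylD a z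
    have f₁ := hasDerivAt_parabolicCylD_add_one a z
    have g := (hasDerivAt_parabolicCylD (-a - 1) (κ * z)).comp z hκz
    have g₁ := (hasDerivAt_parabolicCylD_add_one (-a - 1) (κ * z)).comp z hκz
    rw [sub_add_cancel] at g g₁
    refine ((((f.const_mul κ).mul g₁).sub (f₁.mul g)).add
      (((hasDerivAt_id z).fun_mul f).mul g)).congr_deriv ?_
    simp only [Function.comp_apply, id]
    linear_combination (z / 2 * (z * parabolicCylD a z - parabolicCylD (a + 1) z) *
      parabolicCylD (-a - 1) (κ * z) - a * parabolicCylD a z * parabolicCylD (-a - 1) (κ * z) -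
      κ * z / 2 * parabolicCylD a z * parabolicCylD (-a) (κ * z)) * hκ
  have hconst : W z = W 0 :=
    is_const_of_deriv_eq_zero (fun z => (hd z).differentiableAt) (fun z => (hd z).deriv) z 0
  have h0 : W 0 = κ * Complex.cos (Real.pi * a / 2) + Complex.sin (Real.pi * a / 2) := by
    have h1 := parabolicCylDZero_mul_neg (a + 1)
    rw [show (Real.pi : ℂ) * (a + 1) / 2 = Real.pi * a / 2 + Real.pi / 2 by ring,
      Complex.cos_add_pi_div_two, neg_add'] at h1
    simp only [hW, mul_zero, parabolicCylD_zero_right, zero_mul, add_zero]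
    rw [h1, mul_assoc, parabolicCylDZero_mul_neg]
    ring
  change W z ≠ 0
  rw [hconst, h0]
  intro h
  have hsq := Complex.sin_sq_add_cos_sq (Real.pi * a / 2)
  -- `(cos - κ sin)(cos + κ sin) = cos² + sin² = 1`, so neither factor vanishes.
  refine one_ne_zero (α := ℂ) ?_
  linear_combination -hsq + (Complex.sin (Real.pi * a / 2) - κ * Complex.cos (Real.pi * a / 2)) * h
    + Complex.cos (Real.pi * a / 2) ^ 2 * hκ

/-! ### Weights of words -/

/-- The factor contributed by a letter `m` with neighbours `l` and `r`: `X` for a peak of pattern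
132, `Z` for a peak of pattern 231, `y` for a double descent, `w` for a double rise, `1`
otherwise. -/
def letterWeight {R : Type*} [One R] (X y Z w : R) (l m r : ℕ) : R :=
  if l < m then if r < m then if l ≤ r then X else Z else if m < r then w else 1
  else if m < l ∧ r < m then y else 1

/-- The image of `letterWeight X y Z w l m r` under the derivation with `w ↦ X`, `y ↦ Z` and
`X, Z ↦ X y + Z w`. -/
def letterWeightDeriv {R : Type*} [Semiring R] (X y Z w : R) (l m r : ℕ) : R :=
  if l < m then if r < m then X * y + Z * w else if m < r then X else 0
  else if m < l ∧ r < m then Z else 0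

/-- The product of the letter weights of the first `M` letters of the word `a`. At index `0` the
left neighbour is `a 0` itself, which for `a 0 = 0` gives the factor `1`. -/
def wordWeight {R : Type*} [CommMonoid R] (X y Z w : R) (M : ℕ) (a : ℕ → ℕ) : R :=
  ∏ i ∈ Finset.range M, letterWeight X y Z w (a (i - 1)) (a i) (a (i + 1))

/-- The word `a` with the letter `N` inserted between `a k` and `a (k + 1)`. -/
def insertLetter (N k : ℕ) (a : ℕ → ℕ) (i : ℕ) : ℕ :=
  if i ≤ k then a i else if i = k + 1 then N else a (i - 1)

/-- If `g` is `f` with the entry at `j` replaced by two entries, the product of `g` is that of `f`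
with the factor `f j` replaced by `g j * g (j + 1)`. -/
theorem prod_range_succ_eq_mul_prod_erase {R : Type*} [CommMonoid R] {f g : ℕ → R} {M j : ℕ}
    (hj : j < M) (hlt : ∀ i < j, g i = f i) (hgt : ∀ i, j < i → g (i + 1) = f i) :
    ∏ i ∈ Finset.range (M + 1), g i =
      (∏ i ∈ (Finset.range M).erase j, f i) * (g j * g (j + 1)) := by
  induction M, hj using Nat.le_induction with
  | base =>
    rw [Finset.prod_range_succ, Finset.prod_range_succ, mul_assoc, Finset.range_add_one,
      Finset.erase_insert Finset.notMem_range_self]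
    exact congrArg (· * _) (Finset.prod_congr rfl fun i hi => hlt i (Finset.mem_range.1 hi))
  | succ M hM ih =>
    rw [Finset.prod_range_succ, ih, hgt M hM, Finset.range_add_one (n := M),
      Finset.erase_insert_of_ne (by omega), Finset.prod_insert (by simp)]
    rw [mul_comm (f M), mul_assoc, mul_assoc, mul_assoc]
    simp only [mul_comm, mul_left_comm]

/-! ### Insertion of a maximal letter into a word -/

section Insertion

variable {R : Type*} [CommSemiring R] (X y Z w : R)

/-- Inserting a maximal letter into an ascent makes it a peak of pattern 132; the top `a (k + 1)` of
the ascent becomes a double descent or a valley, and no other letter is affected. -/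
theorem wordWeight_insertLetter_of_lt {a : ℕ → ℕ} {N k M : ℕ} (ha : ∀ i, a i < N)
    (hk : k + 1 < M) (h : a k < a (k + 1)) :
    wordWeight X y Z w (M + 1) (insertLetter N k a) =
      (∏ i ∈ (Finset.range M).erase (k + 1),
        letterWeight X y Z w (a (i - 1)) (a i) (a (i + 1))) *
        (X * if a (k + 2) < a (k + 1) then y else 1) := by
  rw [wordWeight, prod_range_succ_eq_mul_prod_erase hk
    (f := fun i => letterWeight X y Z w (a (i - 1)) (a i) (a (i + 1)))]
  · have h1 := ha k
    have h2 := ha (k + 1)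
    have h3 : ¬ N < a (k + 1) := by omega
    simp [insertLetter, letterWeight, h1, h2, h.le, h3, show ¬ k + 1 + 1 < k by omega,
      show k + 1 + 1 ≠ k by omega]
  · intro i hi
    rcases Nat.lt_or_ge i k with hik | hik
    · simp [insertLetter, show i ≤ k by omega, show i ≤ k + 1 by omega,
        show i + 1 ≤ k by omega]
    · obtain rfl : i = k := by omega
      have h1 := ha i
      simp [insertLetter, letterWeight, h, h1, h.not_gt, h1.not_gt]
  · intro i hi
    simp [insertLetter, show i + 1 ≠ k by omega, show ¬ i + 1 ≤ k by omega, show ¬ i ≤ k by omega,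
      show i ≠ k by omega, show i ≠ k + 1 by omega, show ¬ i + 1 + 1 ≤ k by omega]

/-- Inserting a maximal letter into a descent makes it a peak of pattern 231; the top `a k` of the
descent becomes a double rise or a valley, and no other letter is affected. -/
theorem wordWeight_insertLetter_of_gt {a : ℕ → ℕ} {N k M : ℕ} (ha : ∀ i, a i < N)
    (hk : k < M) (h : a (k + 1) < a k) :
    wordWeight X y Z w (M + 1) (insertLetter N k a) =
      (∏ i ∈ (Finset.range M).erase k,
        letterWeight X y Z w (a (i - 1)) (a i) (a (i + 1))) *
        (Z * if a (k - 1) < a k then w else 1) := by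
  rw [wordWeight, prod_range_succ_eq_mul_prod_erase hk
    (f := fun i => letterWeight X y Z w (a (i - 1)) (a i) (a (i + 1)))]
  · have h1 := ha k
    have h2 := ha (k + 1)
    simp [insertLetter, letterWeight, h1, h2, h.not_ge, h1.not_gt, mul_comm]
  · intro i hi
    simp [insertLetter, show i ≤ k by omega, show i ≤ k + 1 by omega,
        show i + 1 ≤ k by omega]
  · intro i hi
    rcases Nat.lt_or_ge (k + 1) i with hik | hik
    · simp [insertLetter, show i + 1 ≠ k by omega, show ¬ i + 1 ≤ k by omega, show ¬ i ≤ k by omega,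
        show i ≠ k by omega, show i ≠ k + 1 by omega, show ¬ i + 1 + 1 ≤ k by omega]
    · obtain rfl : i = k + 1 := by omega
      have h1 := ha (k + 1)
      simp [insertLetter, letterWeight, h, h1, h.not_gt, h1.not_gt, show ¬ k + 1 + 1 < k by omega,
      show k + 1 + 1 ≠ k by omega]

/-- Inserting a new maximum in all gaps of a word acts on its weight as a derivation. The gap
between `a k` and `a (k + 1)` is charged to the larger of the two letters; every letter other than
that one keeps its weight. -/
theorem sum_wordWeight_insertLetter {a : ℕ → ℕ} {N n : ℕ} (ha : ∀ i, a i < N) (h0 : a 0 = 0)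
    (hn : a (n + 1) = 0) (hne : ∀ k ≤ n, a k ≠ a (k + 1)) :
    ∑ k ∈ Finset.range (n + 1), wordWeight X y Z w (n + 3) (insertLetter N k a) =
      ∑ i ∈ Finset.range (n + 2), (∏ j ∈ (Finset.range (n + 2)).erase i,
        letterWeight X y Z w (a (j - 1)) (a j) (a (j + 1))) *
        letterWeightDeriv X y Z w (a (i - 1)) (a i) (a (i + 1)) := by
  set P : ℕ → R := fun i => ∏ j ∈ (Finset.range (n + 2)).erase i,
        letterWeight X y Z w (a (j - 1)) (a j) (a (j + 1))
  -- `U i` and `V i` are the contributions of the gaps before and after the letter `a i`.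
  set U : ℕ → R := fun i => if a (i - 1) < a i then
    P i * (X * if a (i + 1) < a i then y else 1) else 0 with hU
  set V : ℕ → R := fun i => if a (i + 1) < a i then
    P i * (Z * if a (i - 1) < a i then w else 1) else 0 with hV
  have h1 : ∀ k ∈ Finset.range (n + 1),
      wordWeight X y Z w (n + 3) (insertLetter N k a) = U (k + 1) + V k := by
    intro k hk
    have hk := Finset.mem_range.1 hk
    rcases lt_or_gt_of_ne (hne k (by omega)) with h | h
    · simp [hU, hV, h, h.not_gt, P,
        wordWeight_insertLetter_of_lt X y Z w ha (show k + 1 < n + 2 by omega) h]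
    · simp [hU, hV, h, h.not_gt, P,
        wordWeight_insertLetter_of_gt X y Z w ha (show k < n + 2 by omega) h]
  have hU0 : U 0 = 0 := by simp [hU]
  have hVn : V (n + 1) = 0 := by simp [hV, hn]
  rw [Finset.sum_congr rfl h1, Finset.sum_add_distrib]
  have h2 : ∑ k ∈ Finset.range (n + 1), U (k + 1) = ∑ i ∈ Finset.range (n + 2), U i := by
    rw [Finset.sum_range_succ' U (n + 1), hU0, add_zero]
  have h3 : ∑ k ∈ Finset.range (n + 1), V k = ∑ i ∈ Finset.range (n + 2), V i := by
    rw [Finset.sum_range_succ V (n + 1), hVn, add_zero]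
  rw [h2, h3, ← Finset.sum_add_distrib]
  refine Finset.sum_congr rfl fun i hi => ?_
  change U i + V i = P i * _
  have hi := Finset.mem_range.1 hi
  -- Neighbouring letters differ except at the boundary zeros, so a letter above exactly one of
  -- its neighbours lies strictly below the other.
  have hl : ¬ a (i - 1) < a i → a (i + 1) < a i → a i < a (i - 1) := by
    intro h h'
    rcases Nat.eq_zero_or_pos i with rfl | hpos
    · omega
    · have := hne (i - 1) (by omega)
      rw [Nat.sub_add_cancel hpos] at this
      omega
  have hr : a (i - 1) < a i → ¬ a (i + 1) < a i → a i < a (i + 1) := by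
    intro h h'
    rcases Nat.lt_or_ge n i with hlt | hle
    · obtain rfl : i = n + 1 := by omega
      omega
    · have := hne i hle
      omega
  by_cases hA : a (i - 1) < a i <;> by_cases hB : a (i + 1) < a i
  · simp [hU, hV, letterWeightDeriv, hA, hB, mul_add]
  · simp [hU, hV, letterWeightDeriv, hA, hB, hr hA hB]
  · simp [hU, hV, letterWeightDeriv, hA, hB, hl hA hB]
  · simp [hU, hV, letterWeightDeriv, hA, hB]

end Insertion

/-! ### Insertion of the maximum into a permutation -/

theorem permLetter_zero_right {n : ℕ} (π : Equiv.Perm (Fin n)) : permLetter π 0 = 0 := by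
  simp [permLetter]

theorem permLetter_of_lt {n : ℕ} (π : Equiv.Perm (Fin n)) {i : ℕ} (h : n < i) :
    permLetter π i = 0 := by
  simp [permLetter, h]

theorem permLetter_lt {n : ℕ} (π : Equiv.Perm (Fin n)) (i : ℕ) : permLetter π i < n + 1 := by
  unfold permLetter
  split_ifs <;> omega

theorem permLetter_ne_succ {n : ℕ} (hn : n ≠ 0) (π : Equiv.Perm (Fin n)) {k : ℕ} (hk : k ≤ n) :
    permLetter π k ≠ permLetter π (k + 1) := by
  unfold permLetter
  split_ifs with h1 h2 h2
  · intro h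
    have := π.injective (Fin.ext (Nat.succ_injective h))
    simp only [Fin.mk.injEq] at this
    omega
  · omega
  · omega
  · omega

/-- The boundary letters of the word of a permutation have weight `1`, so the product over the
indices `0, …, n + 1` is the product over `1, …, n`. -/
theorem permWeight_eq_wordWeight {R : Type*} [CommSemiring R] (X y Z w : R) {n : ℕ}
    (π : Equiv.Perm (Fin n)) :
    X ^ numPeak132 π * 1 ^ numPeak132 π * 1 ^ numPeak231 π * Z ^ numPeak231 π *
      y ^ numDoubleDescent π * w ^ numDoubleRise π =
    wordWeight X y Z w (n + 2) (permLetter π) := by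
  have hw : wordWeight X y Z w (n + 2) (permLetter π) = ∏ i ∈ Finset.Icc 1 n,
      letterWeight X y Z w (permLetter π (i - 1)) (permLetter π i) (permLetter π (i + 1)) := by
    symm
    refine Finset.prod_subset (fun i hi => ?_) fun i _ hi => ?_
    · simp only [Finset.mem_Icc, Finset.mem_range] at hi ⊢
      omega
    · have h0 : permLetter π i = 0 := by
        rw [Finset.mem_Icc, not_and_or] at hi
        rcases hi with hi | hi
        · rw [show i = 0 by omega, permLetter_zero_right]
        · exact permLetter_of_lt π (by omega)
      have h1 : permLetter π (i - 1) = 0 ∨ permLetter π (i + 1) = 0 := by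
        rw [Finset.mem_Icc, not_and_or] at hi
        rcases hi with hi | hi
        · left; rw [show i - 1 = 0 by omega, permLetter_zero_right]
        · right; exact permLetter_of_lt π (by omega)
      rw [h0]
      simp [letterWeight]
  rw [hw, numPeak132, numPeak231, numDoubleDescent, numDoubleRise, one_pow, one_pow, mul_one,
    mul_one]
  simp only [← Finset.prod_const, Finset.prod_filter, ← Finset.prod_mul_distrib]
  refine Finset.prod_congr rfl fun i _ => ?_
  generalize permLetter π (i - 1) = l
  generalize permLetter π i = m
  generalize permLetter π (i + 1) = r
  unfold letterWeight
  split_ifs <;> first | omega | simp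

/-- Insertion of a new maximal value at position `k`. -/
def insertMax {n : ℕ} (k : Fin (n + 1)) (π : Equiv.Perm (Fin n)) : Equiv.Perm (Fin (n + 1)) :=
  ((finSuccEquiv' k).trans (Equiv.optionCongr π)).trans (finSuccEquiv' (Fin.last n)).symm

theorem insertMax_apply_self {n : ℕ} (k : Fin (n + 1)) (π : Equiv.Perm (Fin n)) :
    insertMax k π k = Fin.last n := by
  simp [insertMax]

theorem insertMax_apply_succAbove {n : ℕ} (k : Fin (n + 1)) (π : Equiv.Perm (Fin n)) (i : Fin n) :
    insertMax k π (k.succAbove i) = (π i).castSucc := by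
  simp [insertMax]

theorem insertMax_bijective (n : ℕ) :
    Function.Bijective fun kπ : Fin (n + 1) × Equiv.Perm (Fin n) => insertMax kπ.1 kπ.2 := by
  rw [Fintype.bijective_iff_injective_and_card]
  refine ⟨?_, by simp [Fintype.card_perm, Nat.factorial_succ]⟩
  rintro ⟨k, π⟩ ⟨k', π'⟩ h
  simp only at h
  obtain rfl : k = k' := (insertMax k π).injective <| by
    rw [insertMax_apply_self, h, insertMax_apply_self]
  refine Prod.ext rfl (Equiv.ext fun i => Fin.castSucc_injective n ?_)
  rw [← insertMax_apply_succAbove k π, h, insertMax_apply_succAbove]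

theorem permLetter_insertMax {n : ℕ} (k : Fin (n + 1)) (π : Equiv.Perm (Fin n)) :
    permLetter (insertMax k π) = insertLetter (n + 1) k (permLetter π) := by
  ext i
  have hk := k.2
  unfold insertLetter
  split_ifs with h1 h2
  · rcases Nat.eq_zero_or_pos i with rfl | hpos
    · rw [permLetter_zero_right, permLetter_zero_right]
    · have h := insertMax_apply_succAbove k π ⟨i - 1, by omega⟩
      rw [Fin.succAbove_of_castSucc_lt _ _ (Fin.lt_def.2 (by simp; omega))] at h
      rw [permLetter, permLetter, dif_pos (by omega), dif_pos (by omega)]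
      exact congrArg (fun j : Fin (n + 1) => (j : ℕ) + 1) h
  · subst h2
    rw [permLetter, dif_pos (by omega)]
    exact congrArg (fun j : Fin (n + 1) => (j : ℕ) + 1) (insertMax_apply_self k π)
  · rcases Nat.lt_or_ge (n + 1) i with hlt | hle
    · rw [permLetter_of_lt _ hlt, permLetter_of_lt _ (by omega)]
    · have h := insertMax_apply_succAbove k π ⟨i - 1 - 1, by omega⟩
      rw [Fin.succAbove_of_le_castSucc _ _ (Fin.le_def.2 (by simp; omega))] at h
      rw [permLetter, permLetter, dif_pos (by omega), dif_pos (by omega)]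
      have he : (⟨i - 1, by omega⟩ : Fin (n + 1)) = Fin.succ ⟨i - 1 - 1, by omega⟩ :=
        Fin.ext (by simp; omega)
      rw [he]
      exact congrArg (fun j : Fin (n + 1) => (j : ℕ) + 1) h

/-- `Q_n` depends on `x, v` and `z, u` only through `x v` and `z u`. -/
theorem polyQ_eq_polyQ_one_one {R : Type*} [CommSemiring R] (n : ℕ) (x y z w u v : R) :
    polyQ n x y z w u v = polyQ n (x * v) y (z * u) w 1 1 := by
  unfold polyQ
  split_ifs with h
  · rfl
  · refine Finset.sum_congr rfl fun π _ => ?_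
    rw [mul_pow, mul_pow, one_pow, one_pow]
    ring

theorem polyQ_eq_sum_wordWeight {R : Type*} [CommSemiring R] {n : ℕ} (hn : n ≠ 0) (X y Z w : R) :
    polyQ n X y Z w 1 1 =
      ∑ π : Equiv.Perm (Fin n), wordWeight X y Z w (n + 2) (permLetter π) := by
  rw [polyQ, if_neg hn]
  exact Finset.sum_congr rfl fun π _ => permWeight_eq_wordWeight X y Z w π

/-- For `n ≠ 0`, `Q_{n+1}` is the image of `Q_n` under the derivation of `letterWeightDeriv`,
expanded by the Leibniz rule. -/
theorem polyQ_succ_eq_sum {R : Type*} [CommSemiring R] {n : ℕ} (hn : n ≠ 0) (X y Z w : R) :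
    polyQ (n + 1) X y Z w 1 1 = ∑ π : Equiv.Perm (Fin n), ∑ i ∈ Finset.range (n + 2),
      (∏ j ∈ (Finset.range (n + 2)).erase i,
        letterWeight X y Z w (permLetter π (j - 1)) (permLetter π j) (permLetter π (j + 1))) *
        letterWeightDeriv X y Z w (permLetter π (i - 1)) (permLetter π i)
          (permLetter π (i + 1)) := by
  rw [polyQ_eq_sum_wordWeight n.succ_ne_zero, ← (insertMax_bijective n).sum_comp,
    Fintype.sum_prod_type_right]
  refine Finset.sum_congr rfl fun π _ => ?_
  rw [← sum_wordWeight_insertLetter X y Z w (permLetter_lt π) (permLetter_zero_right π)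
    (permLetter_of_lt π n.lt_succ_self) (fun k hk => permLetter_ne_succ hn π hk),
    ← Fin.sum_univ_eq_sum_range fun k =>
      wordWeight X y Z w (n + 3) (insertLetter (n + 1) k (permLetter π))]
  simp only [permLetter_insertMax]

theorem polyQ_one_eq {R : Type*} [CommSemiring R] (X y Z w : R) : polyQ 1 X y Z w 1 1 = X := by
  rw [polyQ_eq_sum_wordWeight one_ne_zero, Fintype.sum_unique]
  simp [wordWeight, Finset.prod_range_succ, letterWeight, permLetter]

/-- Along a solution of `F' = X`, `G' = Z`, `X' = Z' = X G + Z F`, differentiation turns `Q_n`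
into `Q_{n+1}`. -/
theorem hasDerivAt_polyQ {X G Z F : ℂ → ℂ} {t : ℂ} (hF : HasDerivAt F (X t) t)
    (hG : HasDerivAt G (Z t) t) (hX : HasDerivAt X (X t * G t + Z t * F t) t)
    (hZ : HasDerivAt Z (X t * G t + Z t * F t) t) (n : ℕ) :
    HasDerivAt (fun t => polyQ n (X t) (G t) (Z t) (F t) 1 1)
      (polyQ (n + 1) (X t) (G t) (Z t) (F t) 1 1) t := by
  rcases eq_or_ne n 0 with rfl | hn
  · rw [zero_add, polyQ_one_eq]
    simpa [polyQ] using hF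
  · simp only [polyQ_eq_sum_wordWeight hn, polyQ_succ_eq_sum hn]
    refine HasDerivAt.fun_sum fun π _ => ?_
    refine HasDerivAt.fun_finsetProd fun i _ => ?_
    generalize permLetter π (i - 1) = l
    generalize permLetter π i = m
    generalize permLetter π (i + 1) = r
    unfold letterWeight letterWeightDeriv
    split_ifs <;> first | assumption | exact hasDerivAt_const t 1

/-! ### The Riccati equation -/

/-- A solution `F` of the Riccati equation is the generating function of the `Q_n`: with
`G = F - L`, `X = F G + (x v - y w)` and `Z = X - (x v - z u)` it solves the system of
`hasDerivAt_polyQ`. -/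
theorem hasSum_polyQ_of_riccati {ρ : ℝ} {F : ℂ → ℂ} (x y z w u v : ℂ) (hF0 : F 0 = w)
    (hF : ∀ t ∈ Metric.ball (0 : ℂ) ρ, HasDerivAt F
      (F t * (F t - ((x * v - z * u) * t + (w - y))) + (x * v - y * w)) t)
    {t : ℂ} (ht : t ∈ Metric.ball (0 : ℂ) ρ) :
    HasSum (fun n : ℕ => polyQ n x y z w u v * (t ^ n / (n.factorial : ℂ))) (F t) := by
  set G : ℂ → ℂ := fun t => F t - ((x * v - z * u) * t + (w - y)) with hGdef
  set X : ℂ → ℂ := fun t => F t * G t + (x * v - y * w) with hXdef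
  set Z : ℂ → ℂ := fun t => X t - (x * v - z * u) with hZdef
  have hF' : ∀ t ∈ Metric.ball (0 : ℂ) ρ, HasDerivAt F (X t) t := hF
  have hG : ∀ t ∈ Metric.ball (0 : ℂ) ρ, HasDerivAt G (Z t) t := fun t ht => by
    refine ((hF' t ht).sub (((hasDerivAt_id t).const_mul (x * v - z * u)).add_const
      (w - y))).congr_deriv ?_
    simp [hZdef]
  have hX : ∀ t ∈ Metric.ball (0 : ℂ) ρ, HasDerivAt X (X t * G t + Z t * F t) t := fun t ht => by
    refine (((hF' t ht).mul (hG t ht)).add_const (x * v - y * w)).congr_deriv ?_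
    ring
  have hZ : ∀ t ∈ Metric.ball (0 : ℂ) ρ, HasDerivAt Z (X t * G t + Z t * F t) t := fun t ht =>
    (hX t ht).sub_const _
  have hiter : ∀ n : ℕ, ∀ t ∈ Metric.ball (0 : ℂ) ρ,
      iteratedDeriv n F t = polyQ n (X t) (G t) (Z t) (F t) 1 1 := by
    intro n
    induction n with
    | zero => intro t _; simp [polyQ]
    | succ n ih =>
      intro t ht
      rw [iteratedDeriv_succ]
      have he : iteratedDeriv n F =ᶠ[nhds t] fun t => polyQ n (X t) (G t) (Z t) (F t) 1 1 :=
        Filter.eventuallyEq_of_mem (Metric.isOpen_ball.mem_nhds ht) ih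
      rw [he.deriv_eq]
      exact (hasDerivAt_polyQ (hF' t ht) (hG t ht) (hX t ht) (hZ t ht) n).deriv
  have hρ : 0 < ρ := Metric.pos_of_mem_ball ht
  have hd : DifferentiableOn ℂ F (Metric.ball 0 ρ) := fun t ht =>
    (hF t ht).differentiableAt.differentiableWithinAt
  refine (Complex.hasSum_taylorSeries_on_ball hd ht).congr_fun fun n => ?_
  rw [hiter n 0 (Metric.mem_ball_self hρ), polyQ_eq_polyQ_one_one]
  have hG0 : G 0 = y := by simp [hGdef, hF0]
  have hX0 : X 0 = x * v := by simp [hXdef, hF0, hG0]; ring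
  have hZ0 : Z 0 = z * u := by simp [hZdef, hX0]
  rw [hG0, hX0, hZ0, hF0, sub_zero, smul_eq_mul, smul_eq_mul]
  ring

/-- The quotient of the two components of a solution of this linear system solves a Riccati
equation. -/
theorem hasDerivAt_div_of_linear_system {N D : ℂ → ℂ} {L m t : ℂ}
    (hN : HasDerivAt N (m * D t - L / 2 * N t) t) (hD : HasDerivAt D (L / 2 * D t - N t) t)
    (h : D t ≠ 0) :
    HasDerivAt (fun t => N t / D t) (N t / D t * (N t / D t - L) + m) t := by
  refine (hN.div hD h).congr_deriv ?_
  field_simp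
  ring

theorem mainTheorem2 (x y z w u v δ δ' p q r s : ℂ) (hne : x * v ≠ z * u)
    (hδ : δ ^ 2 = x * v - z * u) (hδ' : δ' ^ 2 = z * u - x * v)
    (hp : p = parabolicCylD ((z * u - y * w) / δ ^ 2) ((w - y) / δ))
    (hq : q = parabolicCylD ((x * v - y * w) / δ' ^ 2) ((y - w) / δ'))
    (hr : r = parabolicCylD ((x * v - y * w) / δ ^ 2) ((w - y) / δ))
    (hs : s = parabolicCylD ((z * u - y * w) / δ' ^ 2) ((y - w) / δ')) :
    ∃ ρ : ℝ, 0 < ρ ∧ ∀ t : ℂ, ‖t‖ < ρ →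
      (δ' * s - q * y) * parabolicCylD ((z * u - y * w) / δ ^ 2) (δ * t + (w - y) / δ)
        + (p * w - δ * r) * parabolicCylD ((x * v - y * w) / δ' ^ 2) (δ' * t + (y - w) / δ') ≠ 0 ∧
      HasSum (fun n : ℕ => polyQ n x y z w u v * (t ^ n / (n.factorial : ℂ)))
        ((δ ^ 2 * t + w - y) * (p * w - δ * r)
              * parabolicCylD ((x * v - y * w) / δ' ^ 2) (δ' * t + (y - w) / δ')
            / ((δ' * s - q * y) * parabolicCylD ((z * u - y * w) / δ ^ 2) (δ * t + (w - y) / δ)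
              + (p * w - δ * r)
                * parabolicCylD ((x * v - y * w) / δ' ^ 2) (δ' * t + (y - w) / δ'))
          + (δ * (δ' * s - q * y)
                * parabolicCylD ((x * v - y * w) / δ ^ 2) (δ * t + (w - y) / δ)
              + δ' * (p * w - δ * r)
                * parabolicCylD ((z * u - y * w) / δ' ^ 2) (δ' * t + (y - w) / δ'))
            / ((δ' * s - q * y) * parabolicCylD ((z * u - y * w) / δ ^ 2) (δ * t + (w - y) / δ)
              + (p * w - δ * r)
                * parabolicCylD ((x * v - y * w) / δ' ^ 2) (δ' * t + (y - w) / δ'))) := by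
  have hc : x * v - z * u ≠ 0 := sub_ne_zero.2 hne
  have hδ0 : δ ≠ 0 := by rintro rfl; exact hc (by rw [← hδ]; ring)
  have hsq : δ' ^ 2 = -δ ^ 2 := by rw [hδ, hδ']; ring
  have hδ'0 : δ' ≠ 0 := by rintro rfl; exact hδ0 (by simpa using hsq)
  -- With `a = (z u - y w) / δ²` the four orders are `a`, `a + 1`, `-a - 1` and `-a`.
  set a : ℂ := (z * u - y * w) / δ ^ 2 with ha
  have hac : δ ^ 2 * a = z * u - y * w := by rw [ha]; field_simp
  have e1 : (x * v - y * w) / δ ^ 2 = a + 1 := by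
    rw [ha]; field_simp; rw [hδ]; ring
  have e2 : (x * v - y * w) / δ' ^ 2 = -a - 1 := by
    rw [hsq, div_neg, e1]; ring
  have e3 : (z * u - y * w) / δ' ^ 2 = -a := by
    rw [hsq, div_neg]
  rw [e2] at hq
  rw [e1] at hr
  rw [e3] at hs
  rw [e1, e2, e3]
  set A : ℂ := δ' * s - q * y with hA
  set B : ℂ := p * w - δ * r with hB
  set f : ℂ → ℂ := fun t => parabolicCylD a (δ * t + (w - y) / δ) with hf
  set f₁ : ℂ → ℂ := fun t => parabolicCylD (a + 1) (δ * t + (w - y) / δ) with hf₁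
  set g : ℂ → ℂ := fun t => parabolicCylD (-a - 1) (δ' * t + (y - w) / δ') with hg
  set g₁ : ℂ → ℂ := fun t => parabolicCylD (-a) (δ' * t + (y - w) / δ') with hg₁
  have hlin : ∀ c d t : ℂ, HasDerivAt (fun t => c * t + d) c t := fun c d t => by
    simpa using ((hasDerivAt_id t).const_mul c).add_const d
  have hL : ∀ t, δ * (δ * t + (w - y) / δ) = δ ^ 2 * t + w - y := fun t => by
    field_simp; ring
  have hL' : ∀ t, δ' * (δ' * t + (y - w) / δ') = -(δ ^ 2 * t + w - y) := fun t => by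
    field_simp; rw [hsq]; ring
  have df : ∀ t, HasDerivAt f ((δ ^ 2 * t + w - y) / 2 * f t - δ * f₁ t) t := fun t => by
    refine ((hasDerivAt_parabolicCylD a _).comp t (hlin δ ((w - y) / δ) t)).congr_deriv ?_
    rw [← hL]; ring
  have df₁ : ∀ t, HasDerivAt f₁
      (-((δ ^ 2 * t + w - y) / 2) * f₁ t + δ * (a + 1) * f t) t := fun t => by
    refine ((hasDerivAt_parabolicCylD_add_one a _).comp t (hlin δ ((w - y) / δ) t)).congr_deriv ?_
    rw [← hL]; ring
  have dg : ∀ t, HasDerivAt g (-((δ ^ 2 * t + w - y) / 2) * g t - δ' * g₁ t) t := fun t => by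
    have h := (hasDerivAt_parabolicCylD (-a - 1) _).comp t (hlin δ' ((y - w) / δ') t)
    rw [sub_add_cancel] at h
    refine (h).congr_deriv ?_
    linear_combination g t / 2 * hL' t
  have dg₁ : ∀ t, HasDerivAt g₁
      ((δ ^ 2 * t + w - y) / 2 * g₁ t - δ' * a * g t) t := fun t => by
    have h := (hasDerivAt_parabolicCylD_add_one (-a - 1) _).comp t (hlin δ' ((y - w) / δ') t)
    rw [sub_add_cancel] at h
    refine (h).congr_deriv ?_
    linear_combination (-g₁ t / 2) * hL' t
  set D : ℂ → ℂ := fun t => A * f t + B * g t with hD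
  set N : ℂ → ℂ := fun t => (δ ^ 2 * t + w - y) * B * g t + (δ * A * f₁ t + δ' * B * g₁ t) with hN
  have dD : ∀ t, HasDerivAt D ((δ ^ 2 * t + w - y) / 2 * D t - N t) t := fun t => by
    refine (((df t).const_mul A).add ((dg t).const_mul B)).congr_deriv ?_
    simp only [hD, hN]
    ring
  have dN : ∀ t, HasDerivAt N ((x * v - y * w) * D t - (δ ^ 2 * t + w - y) / 2 * N t) t :=
    fun t => by
    have hl : HasDerivAt (fun t => (δ ^ 2 * t + w - y) * B) (δ ^ 2 * B) t := by
      simpa [add_sub_assoc] using (hlin (δ ^ 2) (w - y) t).mul_const B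
    refine ((hl.mul (dg t)).add
      (((df₁ t).const_mul (δ * A)).add ((dg₁ t).const_mul (δ' * B)))).congr_deriv ?_
    simp only [hD, hN]
    have hm : x * v - y * w = δ ^ 2 * a + δ ^ 2 := by rw [hac, hδ]; ring
    rw [hm]
    linear_combination (-(B * a * g t)) * hsq
  have hf0 : f 0 = p := by simp [hf, hp]
  have hf₁0 : f₁ 0 = r := by simp [hf₁, hr]
  have hg0 : g 0 = q := by simp [hg, hq]
  have hg₁0 : g₁ 0 = s := by simp [hg₁, hs]
  have hD0 : D 0 ≠ 0 := by
    -- The Wronskian is used at `κ = δ' / δ`, for which `κ (w - y) / δ = (y - w) / δ'`.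
    have hκ : (δ' / δ) ^ 2 = -1 := by rw [div_pow, hsq]; field_simp
    have hW := parabolicCylD_wronskian_ne_zero a (δ' / δ) ((w - y) / δ) hκ
    have hκz : δ' / δ * ((w - y) / δ) = (y - w) / δ' := by
      field_simp; rw [hsq]; ring
    rw [hκz, ← hp, ← hq, ← hr, ← hs] at hW
    have : D 0 = δ * (δ' / δ * p * s - r * q + (w - y) / δ * p * q) := by
      simp only [hD, hA, hB, hf0, hg0]
      field_simp
      ring
    rw [this]
    exact mul_ne_zero hδ0 hW
  have hF0 : N 0 / D 0 = w := by
    rw [div_eq_iff hD0]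
    simp only [hD, hN, hA, hB, hf0, hg0, hf₁0, hg₁0]
    ring
  obtain ⟨ρ, hρ, hball⟩ := Metric.eventually_nhds_iff_ball.1
    ((dD 0).continuousAt.eventually_ne hD0)
  refine ⟨ρ, hρ, fun t ht => ⟨hball t (mem_ball_zero_iff.2 ht), ?_⟩⟩
  rw [← add_div]
  refine hasSum_polyQ_of_riccati (F := fun t => N t / D t) x y z w u v hF0 (fun t ht => ?_)
    (mem_ball_zero_iff.2 ht)
  refine (hasDerivAt_div_of_linear_system (dN t) (dD t) (hball t ht)).congr_deriv ?_
  rw [hδ]; ring
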